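/- Let $\mathbb{K}$ be a field, let $k \ge 2$ and $p_1 \ge p_2 \ge \dots \ge p_k \ge 1$ be integers, and put $n = p_1 + \dots + p_k$. Let $G = K_{p_1,\dots,p_k}$ be the complete multipartite graph with vertex set $\{x_{ij} : 1 \le i \le k,\ 1 \le j \le p_i\}$, in which $x_{ij}$ and $x_{i'j'}$ are adjacent if and only if $i \ne i'$. Let $S$ be the standard graded polynomial ring over $\mathbb{K}$ whose variables are the $n$ vertices of $G$, and let $J(G) = \left(\prod_{x \in w} x \;\middle|\; w \text{ is a minimal vertex cover of } G\right) \subseteq S$ be the cover ideal of $G$. Let $\deg(J(G))$ denote the maximal cardinality of a minimal vertex cover of $G$, and for $s \ge 1$ let $$J(G)^{(s)} = \bigcap_{\mathfrak{p} \in \operatorname{Ass}(S/J(G))} \left(J(G)^s S_{\mathfrak{p}} \cap S\right)$$ be the $s$-th symbolic power of $J(G)$. For a homogeneous ideal $I$ of $S$ let $\operatorname{reg}(I) = \max\{\, j - i \mid \operatorname{Tor}_i^S(I,\mathbb{K})_j \ne 0 \,\}$ be its Castelnuovo–Mumford regularity. Then, for all $s \ge 1$, $$\operatorname{reg}\left(J(G)^{(s)}\right)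 = s \cdot \deg(J(G)) + p_k - 1 = s(n - p_k) + p_k - 1 .$$ -/

import Mathlib

noncomputable section

/-- The `s`-th symbolic power `I^(s) = ⋂_{P ∈ Ass(R/I)} (I^s R_P ∩ R)`. -/
def symbolicPower {R : Type*} [CommRing R] (I : Ideal R) (s : ℕ) : Ideal R :=
  ⨅ (P : Ideal R) (hP : P ∈ associatedPrimes R (R ⧸ I)),
    haveI : P.IsPrime := hP.1
    ((I ^ s).map (algebraMap R (Localization.AtPrime P))).comap
      (algebraMap R (Localization.AtPrime P))

/-- `w` is an inclusion-minimal vertex cover of `G`. -/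
def IsMinimalVertexCover {V : Type*} (G : SimpleGraph V) (w : Finset V) : Prop :=
  Minimal (fun c : Finset V => G.IsVertexCover (c : Set V)) w

/-- The cover ideal `J(G) = (∏_{x ∈ w} x | w is a minimal vertex cover of G)` in the polynomial
ring over `K` whose variables are the vertices of `G`. -/
def coverIdeal (K : Type*) [Field K] {V : Type*} (G : SimpleGraph V) :
    Ideal (MvPolynomial V K) :=
  Ideal.span {f | ∃ w : Finset V, IsMinimalVertexCover G w ∧ f = ∏ x ∈ w, MvPolynomial.X x}

open Classical in
/-- `deg(J(G))`: the largest cardinality of a minimal vertex cover of `G`. -/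
def degCoverIdeal {V : Type*} [Fintype V] (G : SimpleGraph V) : ℕ :=
  ((Finset.univ : Finset (Finset V)).filter (IsMinimalVertexCover G)).sup Finset.card

/-- The vector space `Z / B`, for subspaces `B ⊆ Z` of a vector space `W`. -/
abbrev Subquotient {K W : Type*} [Field K] [AddCommGroup W] [Module K W] (Z B : Submodule K W) :
    Type _ :=
  Z ⧸ B.submoduleOf Z

/-- A graded free resolution `⋯ → F 2 → F 1 → F 0 → I → 0` of an ideal `I` of the standard graded
polynomial ring `S = K[x_v | v ∈ V]`. Here `F i = ⨁_{b ∈ Gen i} S(-deg i b)` is the graded free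
module with a basis element of degree `deg i b` for each `b ∈ Gen i`. -/
structure GradedFreeResolution {K : Type*} [Field K] {V : Type*}
    (I : Ideal (MvPolynomial V K)) where
  /-- The index set of the basis of the `i`-th free module. -/
  Gen : ℕ → Type
  /-- The degrees of the basis elements. -/
  deg : ∀ i, Gen i → ℕ
  /-- The augmentation `F 0 → I`. -/
  aug : (Gen 0 →₀ MvPolynomial V K) →ₗ[MvPolynomial V K] I
  /-- The differential `F (i + 1) → F i`. -/
  d : ∀ i, (Gen (i + 1) →₀ MvPolynomial V K) →ₗ[MvPolynomial V K] (Gen i →₀ MvPolynomial V K)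
  /-- The augmentation preserves degrees. -/
  aug_homogeneous : ∀ b : Gen 0,
    (aug (Finsupp.single b 1) : MvPolynomial V K).IsHomogeneous (deg 0 b)
  /-- The differentials preserve degrees: every monomial `x^u e_c` occurring in the image of the
  basis element `e_b` has degree `deg b`, where `x^u e_c` has degree `|u| + deg c`. -/
  d_homogeneous : ∀ (i : ℕ) (b : Gen (i + 1)) (c : Gen i) (u : V →₀ ℕ),
    MvPolynomial.coeff u (d i (Finsupp.single b 1) c) ≠ 0 → u.degree + deg i c = deg (i + 1) b
  aug_surjective : Function.Surjective aug
  exact_zero : Function.Exact (d 0) aug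
  exact_succ : ∀ i, Function.Exact (d (i + 1)) (d i)

namespace GradedFreeResolution

variable {K : Type*} [Field K] {V : Type*} {I : Ideal (MvPolynomial V K)}

/-- The differential `F (i + 1) ⊗ K → F i ⊗ K`, where `K = S / (x_v | v ∈ V)` and `F i ⊗ K` is the
`K`-vector space with basis `Gen i`: its matrix consists of the constant coefficients of the matrix
of `F (i + 1) → F i`. -/
def dBar (F : GradedFreeResolution I) (i : ℕ) : (F.Gen (i + 1) →₀ K) →ₗ[K] (F.Gen i →₀ K) :=
  Finsupp.linearCombination K fun b =>
    Finsupp.mapRange MvPolynomial.constantCoeff (map_zero _) (F.d i (Finsupp.single b 1))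

/-- `dBar` is the map induced by `d` modulo the ideal generated by the variables. -/
theorem dBar_mapRange (F : GradedFreeResolution I) (i : ℕ)
    (x : F.Gen (i + 1) →₀ MvPolynomial V K) :
    F.dBar i (Finsupp.mapRange MvPolynomial.constantCoeff (map_zero _) x) =
      Finsupp.mapRange MvPolynomial.constantCoeff (map_zero _) (F.d i x) := by
  induction x using Finsupp.induction_linear with
  | zero => simp
  | add f g hf hg =>
    rw [Finsupp.mapRange_add (map_add _), map_add, hf, hg, map_add,
      Finsupp.mapRange_add (map_add _)]
  | single b r =>
    have h : Finsupp.single b r = r • Finsupp.single b (1 : MvPolynomial V K) := by simp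
    rw [Finsupp.mapRange_single, dBar, Finsupp.linearCombination_single, h, map_smul]
    ext c
    simp

/-- The degree `j` part of `F i ⊗ K`. -/
def part (F : GradedFreeResolution I) (i j : ℕ) : Submodule K (F.Gen i →₀ K) :=
  Finsupp.supported K K {b | F.deg i b = j}

/-- The degree `j` cycles of the complex `F ⊗ K` in homological degree `i`. -/
def cycles (F : GradedFreeResolution I) : (i j : ℕ) → Submodule K (F.Gen i →₀ K)
  | 0, j => F.part 0 j
  | i + 1, j => F.part (i + 1) j ⊓ LinearMap.ker (F.dBar i)

/-- The degree `j` boundaries of the complex `F ⊗ K` in homological degree `i`. -/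
def boundaries (F : GradedFreeResolution I) (i j : ℕ) : Submodule K (F.Gen i →₀ K) :=
  (F.part (i + 1) j).map (F.dBar i)

/-- `Tor_i^S(I, K)_j`, computed with the resolution `F` as the degree `j` part of the `i`-th
homology of the complex `F ⊗ K`. -/
abbrev Tor (F : GradedFreeResolution I) (i j : ℕ) : Type _ :=
  Subquotient (F.cycles i j) (F.boundaries i j)

end GradedFreeResolution

/-- `r` is the Castelnuovo–Mumford regularity `max {j - i | Tor_i^S(I, K)_j ≠ 0}` of `I`. Since
`Tor` does not depend on the resolution, this is required of every graded free resolution of `I`,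
together with the existence of one. -/
def HasRegularity {K : Type*} [Field K] {V : Type*} (I : Ideal (MvPolynomial V K)) (r : ℤ) : Prop :=
  Nonempty (GradedFreeResolution I) ∧ ∀ F : GradedFreeResolution I,
    IsGreatest {m : ℤ | ∃ i j : ℕ, Nontrivial (F.Tor i j) ∧ m = (j : ℤ) - (i : ℤ)} r

end

/-! The associated primes of `S/J(G)` are the ideals `(x, y)` of the edges, and `J(G)` localizes to
`(x, y)` there, so `J(G)^(s)` is the intersection of the `(x, y)^s` over all edges
(`symbolicPower_coverIdeal`). Its monomials are the `x^u` with `u x + u y ≥ s` on every edge.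

For a complete multipartite graph the minimal such `u` are constant on parts: exponent `m < s/2` on
one part and `s - m` on the others, or `s/2` everywhere if `s` is even (`multipartiteTree_ideal`).
For fixed part `i` these form a chain in `m`. Multiplying the `m`-th generator by the product of the
variables of part `i` gives a multiple of the next one. All chains end in a common root: the
constant vector if `s` is even, the middle generator of a chosen part `z` if `s` is odd. These
relations, one per non-root generator, freely generate all relations because they are triangular for
the rank `m` (`treeRelations_exact`), so the ideal has a minimal resolution of length one.

The relation of `(i, m)` has degree `n(s - m) + p_i(2m - s) + p_i`. This is greatest at `m = 0` on a
smallest part, where it is `s(n - p_k) + p_k`; subtracting the homological degree 1 gives the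
regularity, and no generator exceeds it. Since regularity is required of every resolution, the
comparison theorem is proved as well (`nontrivial_tor_of_nontrivial`). -/

noncomputable section
open MvPolynomial

/-! ### Graded maps of free modules and their reduction modulo the variables. -/

namespace GradedFree

variable {K : Type*} [Field K] {V A B C : Type*}

/-- Every monomial `x^u e_c` occurring in `x`, where `e_c` has degree `dB c`, has a degree
satisfying `P`. -/
def DegSupported (dB : B → ℕ) (P : ℕ → Prop) (x : B →₀ MvPolynomial V K) : Prop :=
  ∀ c u, coeff u (x c) ≠ 0 → P (u.degree + dB c)

/-- A linear map of graded free modules, with basis elements of degrees `dA` and `dB`, which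
preserves degrees. -/
def IsGraded (dA : A → ℕ) (dB : B → ℕ)
    (f : (A →₀ MvPolynomial V K) →ₗ[MvPolynomial V K] (B →₀ MvPolynomial V K)) : Prop :=
  ∀ a, DegSupported dB (· = dA a) (f (Finsupp.single a 1))

theorem DegSupported.zero (dB : B → ℕ) (P : ℕ → Prop) :
    DegSupported dB P (0 : B →₀ MvPolynomial V K) := by
  intro c u h
  simp at h

theorem DegSupported.add {dB : B → ℕ} {P : ℕ → Prop} {x y : B →₀ MvPolynomial V K}
    (hx : DegSupported dB P x) (hy : DegSupported dB P y) : DegSupported dB P (x + y) := by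
  intro c u h
  by_cases h1 : coeff u (x c) = 0
  · refine hy c u fun h2 => h ?_
    simp [h1, h2]
  · exact hx c u h1

theorem DegSupported.sub {dB : B → ℕ} {P : ℕ → Prop} {x y : B →₀ MvPolynomial V K}
    (hx : DegSupported dB P x) (hy : DegSupported dB P y) : DegSupported dB P (x - y) := by
  intro c u h
  by_cases h1 : coeff u (x c) = 0
  · refine hy c u fun h2 => h ?_
    simp [h1, h2]
  · exact hx c u h1

theorem DegSupported.eq_zero {dB : B → ℕ} {P : ℕ → Prop} {x : B →₀ MvPolynomial V K}
    (hx : DegSupported dB P x) (hx' : DegSupported dB (fun n => ¬ P n) x) : x = 0 := by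
  ext c u
  by_contra h
  exact hx' c u h (hx c u h)

theorem DegSupported.smul_single {dB : B → ℕ} {P : ℕ → Prop} {d : ℕ} {x : B →₀ MvPolynomial V K}
    (hx : DegSupported dB (· = d) x) (r : MvPolynomial V K)
    (hr : ∀ u, coeff u r ≠ 0 → P (u.degree + d)) : DegSupported dB P (r • x) := by
  classical
  intro c u h
  rw [Finsupp.smul_apply, smul_eq_mul, coeff_mul] at h
  obtain ⟨⟨v, w⟩, hvw, hne⟩ := Finset.exists_ne_zero_of_sum_ne_zero h
  obtain rfl : v + w = u := by simpa using hvw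
  have h1 := hr v (left_ne_zero_of_mul hne)
  have h2 := hx c w (right_ne_zero_of_mul hne)
  rwa [map_add, add_assoc, h2]

theorem exists_split (dB : B → ℕ) (P : ℕ → Prop) (x : B →₀ MvPolynomial V K) :
    ∃ y z, x = y + z ∧ DegSupported dB P y ∧ DegSupported dB (fun n => ¬ P n) z := by
  classical
  induction x using Finsupp.induction_linear with
  | zero => exact ⟨0, 0, by simp, .zero _ _, .zero _ _⟩
  | add f g hf hg =>
    obtain ⟨y, z, rfl, hy, hz⟩ := hf
    obtain ⟨y', z', rfl, hy', hz'⟩ := hg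
    exact ⟨y + y', z + z', by abel, hy.add hy', hz.add hz'⟩
  | single b r =>
    induction r using MvPolynomial.induction_on' with
    | monomial v a =>
      have key : ∀ Q : ℕ → Prop, Q (v.degree + dB b) →
          DegSupported dB Q (Finsupp.single b (monomial v a)) := by
        intro Q hQ c u hu
        by_cases hc : b = c
        · subst hc
          rw [Finsupp.single_eq_same, coeff_monomial] at hu
          obtain rfl : v = u := by by_contra h0; simp [h0] at hu
          exact hQ
        · simp [hc] at hu
      by_cases h : P (v.degree + dB b)
      · exact ⟨_, 0, by simp, key P h, .zero _ _⟩
      · exact ⟨0, _, by simp, .zero _ _, key (fun n => ¬ P n) h⟩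
    | add p q hp hq =>
      obtain ⟨y, z, e, hy, hz⟩ := hp
      obtain ⟨y', z', e', hy', hz'⟩ := hq
      exact ⟨y + y', z + z', by rw [Finsupp.single_add, e, e']; abel, hy.add hy', hz.add hz'⟩

section

variable {dA : A → ℕ} {dB : B → ℕ} {dC : C → ℕ}
  {f f' : (A →₀ MvPolynomial V K) →ₗ[MvPolynomial V K] (B →₀ MvPolynomial V K)}
  {g : (B →₀ MvPolynomial V K) →ₗ[MvPolynomial V K] (C →₀ MvPolynomial V K)}

theorem IsGraded.degSupported (hf : IsGraded dA dB f) {P : ℕ → Prop} {x : A →₀ MvPolynomial V K}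
    (hx : DegSupported dA P x) : DegSupported dB P (f x) := by
  have key : ∀ s : Finset A,
      DegSupported dB P (∑ a ∈ s, x a • f (Finsupp.single a 1)) := by
    classical
    intro s
    induction s using Finset.induction_on with
    | empty => simpa using DegSupported.zero dB P
    | insert a s ha ih =>
      rw [Finset.sum_insert ha]
      exact ((hf a).smul_single (x a) (hx a)).add ih
  have h : f x = ∑ a ∈ x.support, x a • f (Finsupp.single a 1) := by
    conv_lhs => rw [← Finsupp.sum_single x]
    rw [Finsupp.sum, map_sum]
    refine Finset.sum_congr rfl fun a _ => ?_
    rw [← map_smul, Finsupp.smul_single, smul_eq_mul, mul_one]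
  rw [h]
  exact key _

theorem IsGraded.comp (hg : IsGraded dB dC g) (hf : IsGraded dA dB f) :
    IsGraded dA dC (g ∘ₗ f) :=
  fun a => hg.degSupported (hf a)

theorem IsGraded.sub (hf : IsGraded dA dB f) (hf' : IsGraded dA dB f') :
    IsGraded dA dB (f - f') :=
  fun a => (hf a).sub (hf' a)

theorem isGraded_id (dA : A → ℕ) :
    IsGraded dA dA (LinearMap.id : _ →ₗ[MvPolynomial V K] (A →₀ MvPolynomial V K)) := by
  classical
  intro a c u h
  rw [LinearMap.id_apply, Finsupp.single_apply] at h
  split_ifs at h with hc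
  · subst hc
    rw [coeff_one] at h
    obtain rfl : 0 = u := by by_contra h0; simp [h0] at h
    simp
  · simp at h

/-- Graded free modules are projective in the category of graded modules. -/
theorem exists_graded_lift {f : (A →₀ MvPolynomial V K) →ₗ[MvPolynomial V K] (C →₀ MvPolynomial V K)}
    (hf : IsGraded dA dC f) (hg : IsGraded dB dC g) (h : ∀ x, f x ∈ LinearMap.range g) :
    ∃ l : (A →₀ MvPolynomial V K) →ₗ[MvPolynomial V K] (B →₀ MvPolynomial V K),
      IsGraded dA dB l ∧ ∀ x, g (l x) = f x := by
  have key : ∀ a, ∃ y, DegSupported dB (· = dA a) y ∧ g y = f (Finsupp.single a 1) := by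
    intro a
    obtain ⟨x, hx⟩ := h (Finsupp.single a 1)
    obtain ⟨y, z, rfl, hy, hz⟩ := exists_split dB (· = dA a) x
    refine ⟨y, hy, ?_⟩
    -- `g y - f e_a` lies in degree `dA a` but equals `g (-z)`, which has no component in that
    -- degree.
    rw [← sub_eq_zero]
    refine DegSupported.eq_zero ((hg.degSupported hy).sub (hf a)) ?_
    rw [← hx, map_add, sub_add_cancel_left, ← map_neg]
    refine hg.degSupported ?_
    rw [← zero_sub]
    exact (DegSupported.zero _ _).sub hz
  choose y hy hgy using key
  refine ⟨Finsupp.linearCombination _ y, fun a => ?_, fun x => ?_⟩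
  · simpa using hy a
  · have : g ∘ₗ Finsupp.linearCombination (MvPolynomial V K) y = f := by
      ext a : 2
      simp [hgy]
    exact LinearMap.congr_fun this x

end

/-- The map induced by `f` modulo the ideal generated by the variables. -/
def bar (f : (A →₀ MvPolynomial V K) →ₗ[MvPolynomial V K] (B →₀ MvPolynomial V K)) :
    (A →₀ K) →ₗ[K] (B →₀ K) :=
  Finsupp.linearCombination K fun b =>
    Finsupp.mapRange constantCoeff (map_zero _) (f (Finsupp.single b 1))

theorem bar_mapRange (f : (A →₀ MvPolynomial V K) →ₗ[MvPolynomial V K] (B →₀ MvPolynomial V K))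
    (x : A →₀ MvPolynomial V K) :
    bar f (Finsupp.mapRange constantCoeff (map_zero _) x) =
      Finsupp.mapRange constantCoeff (map_zero _) (f x) := by
  induction x using Finsupp.induction_linear with
  | zero => simp
  | add f g hf hg =>
    rw [Finsupp.mapRange_add (map_add _), map_add, hf, hg, map_add,
      Finsupp.mapRange_add (map_add _)]
  | single b r =>
    have h : Finsupp.single b r = r • Finsupp.single b (1 : MvPolynomial V K) := by simp
    rw [Finsupp.mapRange_single, bar, Finsupp.linearCombination_single, h, map_smul]
    ext c
    simp

theorem bar_comp (g : (B →₀ MvPolynomial V K) →ₗ[MvPolynomial V K] (C →₀ MvPolynomial V K))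
    (f : (A →₀ MvPolynomial V K) →ₗ[MvPolynomial V K] (B →₀ MvPolynomial V K)) :
    bar (g ∘ₗ f) = bar g ∘ₗ bar f := by
  refine Finsupp.lhom_ext' fun a => LinearMap.ext_ring ?_
  have h : ∀ {D : Type _} (k : (A →₀ MvPolynomial V K) →ₗ[MvPolynomial V K]
      (D →₀ MvPolynomial V K)), bar k (Finsupp.single a 1) =
        Finsupp.mapRange constantCoeff (map_zero _) (k (Finsupp.single a 1)) := by
    intro D k
    simp [bar]
  simp only [LinearMap.comp_apply, Finsupp.lsingle_apply]
  rw [h f, bar_mapRange]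
  simp [bar]

theorem bar_sub (f g : (A →₀ MvPolynomial V K) →ₗ[MvPolynomial V K] (B →₀ MvPolynomial V K)) :
    bar (f - g) = bar f - bar g := by
  refine Finsupp.lhom_ext' fun a => LinearMap.ext_ring ?_
  ext c
  simp [bar]

theorem bar_add (f g : (A →₀ MvPolynomial V K) →ₗ[MvPolynomial V K] (B →₀ MvPolynomial V K)) :
    bar (f + g) = bar f + bar g := by
  refine Finsupp.lhom_ext' fun a => LinearMap.ext_ring ?_
  ext c
  simp [bar]

theorem bar_id :
    bar (LinearMap.id : _ →ₗ[MvPolynomial V K] (A →₀ MvPolynomial V K)) = LinearMap.id := by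
  refine Finsupp.lhom_ext' fun a => LinearMap.ext_ring ?_
  simp [bar]

theorem bar_mem_supported {dA : A → ℕ} {dB : B → ℕ}
    {f : (A →₀ MvPolynomial V K) →ₗ[MvPolynomial V K] (B →₀ MvPolynomial V K)}
    (hf : IsGraded dA dB f) {j : ℕ} {x : A →₀ K}
    (hx : x ∈ Finsupp.supported K K {a | dA a = j}) :
    bar f x ∈ Finsupp.supported K K {b | dB b = j} := by
  rw [bar, Finsupp.linearCombination_apply, Finsupp.sum]
  refine Submodule.sum_mem _ fun a ha => Submodule.smul_mem _ _ ?_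
  have hj : dA a = j := (Finsupp.mem_supported _ _).1 hx ha
  rw [Finsupp.mem_supported]
  intro b hb
  -- A nonzero constant coefficient is the case `u = 0` of gradedness, so `a` and `b` have equal
  -- degrees.
  have := hf a b 0 (by simpa [constantCoeff_eq] using hb)
  simpa [hj] using this

end GradedFree

/-! ### Comparison of resolutions and independence of Tor. -/

namespace GradedFreeResolution

open GradedFree

variable {K : Type*} [Field K] {V : Type*} {I : Ideal (MvPolynomial V K)}

/-- The kernel of the differential which leaves the `i`-th module of a resolution. -/
def syz (F : GradedFreeResolution I) : (i : ℕ) → Submodule (MvPolynomial V K)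
    (F.Gen i →₀ MvPolynomial V K)
  | 0 => LinearMap.ker F.aug
  | i + 1 => LinearMap.ker (F.d i)

theorem range_d (F : GradedFreeResolution I) (i : ℕ) : LinearMap.range (F.d i) = F.syz i := by
  cases i with
  | zero => exact F.exact_zero.linearMap_ker_eq.symm
  | succ i => exact (F.exact_succ i).linearMap_ker_eq.symm

theorem d_mem_syz (F : GradedFreeResolution I) (i : ℕ) (x) : F.d i x ∈ F.syz i :=
  F.range_d i ▸ LinearMap.mem_range_self _ x

theorem isGraded_d (F : GradedFreeResolution I) (i : ℕ) :
    IsGraded (F.deg (i + 1)) (F.deg i) (F.d i) :=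
  fun b c u h => F.d_homogeneous i b c u h

/-- The augmentation, as a map to the free module `S`. -/
def augFree (F : GradedFreeResolution I) :
    (F.Gen 0 →₀ MvPolynomial V K) →ₗ[MvPolynomial V K] (Unit →₀ MvPolynomial V K) :=
  Finsupp.lsingle () ∘ₗ I.subtype ∘ₗ F.aug

/-- With `S` as target, free on one generator of degree 0, `exists_graded_lift` also applies to
augmentations. -/
theorem isGraded_augFree (F : GradedFreeResolution I) :
    IsGraded (F.deg 0) (fun _ => 0) F.augFree := by
  intro b c u h
  have h' : coeff u (F.aug (Finsupp.single b 1) : MvPolynomial V K) ≠ 0 := by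
    simpa [augFree] using h
  have := F.aug_homogeneous b h'
  rw [add_zero, Finsupp.degree_eq_weight_one]
  exact this

theorem augFree_eq_iff (F F' : GradedFreeResolution I) (x y) :
    F.augFree x = F'.augFree y ↔ F.aug x = F'.aug y := by
  simp [augFree, (Finsupp.single_injective ()).eq_iff]

variable (F F' : GradedFreeResolution I)

/-- A degree preserving map between the `i`-th modules of two resolutions which preserves
syzygies. -/
def SyzMap (i : ℕ) : Type _ :=
  {f : (F.Gen i →₀ MvPolynomial V K) →ₗ[MvPolynomial V K] (F'.Gen i →₀ MvPolynomial V K) //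
    IsGraded (F.deg i) (F'.deg i) f ∧ ∀ x ∈ F.syz i, f x ∈ F'.syz i}

theorem exists_syzMap_zero : ∃ f : F.SyzMap F' 0, ∀ x, F'.aug (f.1 x) = F.aug x := by
  obtain ⟨l, hl, h⟩ := exists_graded_lift F.isGraded_augFree F'.isGraded_augFree (fun x => by
    obtain ⟨y, hy⟩ := F'.aug_surjective (F.aug x)
    exact ⟨y, (augFree_eq_iff _ _ _ _).2 hy⟩)
  have h' : ∀ x, F'.aug (l x) = F.aug x := fun x => (augFree_eq_iff _ _ _ _).1 (h x)
  refine ⟨⟨l, hl, fun x hx => ?_⟩, h'⟩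
  exact (h' x).trans hx

theorem exists_syzMap_succ (i : ℕ) (f : F.SyzMap F' i) :
    ∃ g : F.SyzMap F' (i + 1), ∀ x, F'.d i (g.1 x) = f.1 (F.d i x) := by
  obtain ⟨l, hl, h⟩ := exists_graded_lift (f.2.1.comp (F.isGraded_d i)) (F'.isGraded_d i)
    (fun x => by
      rw [F'.range_d]
      exact f.2.2 _ (F.d_mem_syz i x))
  refine ⟨⟨l, hl, fun x hx => ?_⟩, h⟩
  refine (h x).trans ?_
  have : F.d i x = 0 := hx
  simp [this]

/-- Resolutions of the same ideal are related by a degree preserving chain map. -/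
theorem exists_chainMap : ∃ φ : ∀ i, (F.Gen i →₀ MvPolynomial V K) →ₗ[MvPolynomial V K]
      (F'.Gen i →₀ MvPolynomial V K), (∀ i, IsGraded (F.deg i) (F'.deg i) (φ i)) ∧
    (∀ x, F'.aug (φ 0 x) = F.aug x) ∧ ∀ i x, F'.d i (φ (i + 1) x) = φ i (F.d i x) := by
  obtain ⟨f, hf⟩ := exists_syzMap_zero F F'
  choose g hg using exists_syzMap_succ F F'
  -- Preserving syzygies is all that is needed to lift one step further, so the recursion carries a
  -- single component.
  let φ : ∀ i, F.SyzMap F' i := fun i => Nat.rec f g i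
  exact ⟨fun i => (φ i).1, fun i => (φ i).2.1, hf, fun i x => hg i (φ i) x⟩

section Homotopy

variable {F}
variable {θ : ∀ i, (F.Gen i →₀ MvPolynomial V K) →ₗ[MvPolynomial V K]
  (F.Gen i →₀ MvPolynomial V K)}

variable (F θ) in
/-- A component of a degree preserving homotopy from `θ` to zero. -/
def HomotopyMap (i : ℕ) : Type _ :=
  {h : (F.Gen i →₀ MvPolynomial V K) →ₗ[MvPolynomial V K] (F.Gen (i + 1) →₀ MvPolynomial V K) //
    IsGraded (F.deg i) (F.deg (i + 1)) h ∧ ∀ x ∈ F.syz i, F.d i (h x) = θ i x}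

theorem exists_homotopyMap_zero (hθ : IsGraded (F.deg 0) (F.deg 0) (θ 0))
    (h0 : ∀ x, F.aug (θ 0 x) = 0) :
    ∃ h : F.HomotopyMap θ 0, ∀ x, F.d 0 (h.1 x) = θ 0 x := by
  obtain ⟨l, hl, h⟩ := exists_graded_lift hθ (F.isGraded_d 0) (fun x => by
    rw [F.range_d]
    exact h0 x)
  exact ⟨⟨l, hl, fun x _ => h x⟩, h⟩

/-- `θ - f d` takes values in syzygies since `d f = θ` on the image of `d`. On syzygies the term `f
d` vanishes, so the invariant of `HomotopyMap` persists. -/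
theorem exists_homotopyMap_succ (i : ℕ) (hθ : IsGraded (F.deg (i + 1)) (F.deg (i + 1)) (θ (i + 1)))
    (hd : ∀ x, F.d i (θ (i + 1) x) = θ i (F.d i x)) (f : F.HomotopyMap θ i) :
    ∃ h : F.HomotopyMap θ (i + 1), ∀ x, F.d (i + 1) (h.1 x) = θ (i + 1) x - f.1 (F.d i x) := by
  obtain ⟨l, hl, h⟩ := exists_graded_lift (hθ.sub (f.2.1.comp (F.isGraded_d i)))
    (F.isGraded_d (i + 1)) (fun x => by
      rw [F.range_d]
      change F.d i (θ (i + 1) x - f.1 (F.d i x)) = 0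
      rw [map_sub, hd, f.2.2 _ (F.d_mem_syz i x), sub_self])
  refine ⟨⟨l, hl, fun x hx => ?_⟩, h⟩
  have : F.d i x = 0 := hx
  rw [h]
  simp [this]

/-- A degree preserving chain map which lifts the zero map is homotopic to zero. -/
theorem exists_homotopy (hθ : ∀ i, IsGraded (F.deg i) (F.deg i) (θ i))
    (h0 : ∀ x, F.aug (θ 0 x) = 0) (hd : ∀ i x, F.d i (θ (i + 1) x) = θ i (F.d i x)) :
    ∃ h : ∀ i, (F.Gen i →₀ MvPolynomial V K) →ₗ[MvPolynomial V K]
        (F.Gen (i + 1) →₀ MvPolynomial V K),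
      (∀ i, IsGraded (F.deg i) (F.deg (i + 1)) (h i)) ∧ F.d 0 ∘ₗ h 0 = θ 0 ∧
      ∀ i, F.d (i + 1) ∘ₗ h (i + 1) + h i ∘ₗ F.d i = θ (i + 1) := by
  obtain ⟨f, hf⟩ := exists_homotopyMap_zero (hθ 0) h0
  choose g hg using fun i => exists_homotopyMap_succ i (hθ (i + 1)) (hd i)
  let h : ∀ i, F.HomotopyMap θ i := fun i => Nat.rec f g i
  refine ⟨fun i => (h i).1, fun i => (h i).2.1, LinearMap.ext hf, fun i => LinearMap.ext fun x => ?_⟩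
  have := hg i (h i) x
  exact eq_sub_iff_add_eq.1 this

end Homotopy

theorem nontrivial_tor_iff (i j : ℕ) :
    Nontrivial (F.Tor i j) ↔ ¬ F.cycles i j ≤ F.boundaries i j := by
  refine Submodule.Quotient.nontrivial_iff.trans (not_congr ?_)
  rw [Submodule.submoduleOf, Submodule.comap_subtype_eq_top]

theorem dBar_eq_bar (i : ℕ) : F.dBar i = bar (F.d i) := rfl

theorem cycles_le_part (i j : ℕ) : F.cycles i j ≤ F.part i j := by
  cases i with
  | zero => exact le_rfl
  | succ i => exact inf_le_left

/-- The vanishing of `Tor` does not depend on the resolution. -/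
theorem nontrivial_tor_of_nontrivial {i j : ℕ} (h : Nontrivial (F.Tor i j)) :
    Nontrivial (F'.Tor i j) := by
  rw [nontrivial_tor_iff] at h ⊢
  -- If `φ z` is the boundary of `w`, the homotopy `e` from `ψ φ` to the identity makes `z` the
  -- boundary of `ψ w + e z`.
  contrapose! h
  obtain ⟨φ, hφ, hφ0, hφd⟩ := exists_chainMap F F'
  obtain ⟨ψ, hψ, hψ0, hψd⟩ := exists_chainMap F' F
  obtain ⟨e, he, he0, hed⟩ := exists_homotopy (F := F) (θ := fun i => LinearMap.id - ψ i ∘ₗ φ i)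
    (fun i => (isGraded_id _).sub ((hψ i).comp (hφ i)))
    (fun x => by simp [hψ0, hφ0]) (fun i x => by simp [hψd, hφd])
  have hcycle : ∀ z ∈ F.cycles i j, bar (φ i) z ∈ F'.cycles i j := by
    intro z hz
    have h1 := bar_mem_supported (hφ i) (F.cycles_le_part i j hz)
    cases i with
    | zero => exact h1
    | succ i =>
      refine ⟨h1, ?_⟩
      have h2 : F.dBar i z = 0 := hz.2
      have h3 : F'.d i ∘ₗ φ (i + 1) = φ i ∘ₗ F.d i := LinearMap.ext (hφd i)
      have h4 := congrArg bar h3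
      rw [bar_comp, bar_comp] at h4
      have := LinearMap.congr_fun h4 z
      simp only [LinearMap.comp_apply, ← dBar_eq_bar, h2, map_zero] at this
      exact this
  have hhom : ∀ z ∈ F.cycles i j, z - bar (ψ i) (bar (φ i) z) = F.dBar i (bar (e i) z) := by
    intro z hz
    cases i with
    | zero =>
      have := LinearMap.congr_fun (congrArg bar he0) z
      simp only [bar_sub, bar_comp, bar_id] at this
      exact this.symm
    | succ i =>
      have h2 : F.dBar i z = 0 := hz.2
      have := LinearMap.congr_fun (congrArg bar (hed i)) z
      simp only [bar_sub, bar_add, bar_comp, bar_id, LinearMap.add_apply, LinearMap.comp_apply,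
        ← dBar_eq_bar, h2, map_zero, add_zero] at this
      exact this.symm
  intro z hz
  obtain ⟨w, hw, hwz⟩ := h (hcycle z hz)
  refine ⟨bar (ψ (i + 1)) w + bar (e i) z,
    Submodule.add_mem _ (bar_mem_supported (hψ (i + 1)) hw)
      (bar_mem_supported (he i) (F.cycles_le_part i j hz)), ?_⟩
  have h3 : F.d i ∘ₗ ψ (i + 1) = ψ i ∘ₗ F'.d i := LinearMap.ext (hψd i)
  have h4 := LinearMap.congr_fun (congrArg bar h3) w
  simp only [bar_comp, LinearMap.comp_apply, ← dBar_eq_bar, hwz] at h4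
  rw [map_add, h4, ← hhom z hz]
  abel

end GradedFreeResolution

end

/-! ### Resolutions of length one from a rooted tree of relations. -/

noncomputable section
open MvPolynomial

section TreeResolution

variable {S : Type*} [CommRing S] {A : Type*} (prev : A → Option A) (Y Z : A → S)

/-- The relations `Y a * e_a = Z a * e_(prev a)`. -/
def treeRelations : (A →₀ S) →ₗ[S] (Option A →₀ S) :=
  Finsupp.linearCombination S fun a =>
    Finsupp.single (some a) (Y a) - Finsupp.single (prev a) (Z a)

variable [Fintype A] {prev Y Z} {ρ : A → ℕ}

/-- `prev` strictly raises `ρ`, so apart from the relation of `b` only relations of smaller rank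
involve `e_b`. -/
theorem treeRelations_apply (hρ : ∀ a b, prev a = some b → ρ a < ρ b) (x : A →₀ S) (b : A)
    (hx : ∀ a, ρ a < ρ b → x a = 0) :
    treeRelations prev Y Z x (some b) = x b * Y b := by
  classical
  rw [treeRelations, Finsupp.linearCombination_apply, Finsupp.sum_fintype _ _ (by simp),
    Finsupp.finsetSum_apply, Finset.sum_eq_single b]
  · have : prev b ≠ some b := fun h => (hρ b b h).ne rfl
    simp [this]
  · intro a _ hab
    by_cases h : prev a = some b
    · simp [hx a (hρ a b h)]
    · simp [h, hab]
  · simp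

theorem treeRelations_injective [IsDomain S] (hρ : ∀ a b, prev a = some b → ρ a < ρ b)
    (hY : ∀ a, Y a ≠ 0) : Function.Injective (treeRelations prev Y Z) := by
  rw [injective_iff_map_eq_zero]
  intro x hx
  have key : ∀ n b, ρ b = n → x b = 0 := by
    intro n
    induction n using Nat.strong_induction_on with
    | _ n ih =>
      rintro b rfl
      have h := treeRelations_apply (Y := Y) (Z := Z) hρ x b fun a ha => ih _ ha a rfl
      rw [hx, Finsupp.zero_apply, eq_comm, mul_eq_zero] at h
      exact h.resolve_right (hY b)
  ext b
  exact key _ b rfl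

/-- The relations of a tree generate all relations of `g` if each ideal `(g b | b ≥ a) : g a` is
generated by `Y a`. -/
theorem treeRelations_exact [IsDomain S] (hρ : ∀ a b, prev a = some b → ρ a < ρ b)
    {g : Option A → S} (hg : g none ≠ 0) (hrel : ∀ a, Y a * g (some a) = Z a * g (prev a))
    (hcolon : ∀ a c, Finsupp.linearCombination S g c = 0 →
      (∀ b, ρ b < ρ a → c (some b) = 0) → Y a ∣ c (some a)) :
    Function.Exact (treeRelations prev Y Z) (Finsupp.linearCombination S g) := by
  classical
  have hcomp : ∀ x, Finsupp.linearCombination S g (treeRelations prev Y Z x) = 0 := by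
    intro x
    have : Finsupp.linearCombination S g ∘ₗ treeRelations prev Y Z = 0 := by
      ext a
      simp [treeRelations, hrel]
    exact LinearMap.congr_fun this x
  obtain ⟨N, hN⟩ : ∃ N, ∀ b, ρ b < N :=
    ⟨(Finset.univ.sup ρ) + 1, fun b => Nat.lt_succ_of_le (Finset.le_sup (Finset.mem_univ b))⟩
  -- `c` vanishes on ranks below `N - n`: `n = N` assumes nothing, and for `n = 0` only the root
  -- coefficient is left.
  have key : ∀ n (c : Option A →₀ S), Finsupp.linearCombination S g c = 0 →
      (∀ b, ρ b + n < N → c (some b) = 0) → c ∈ LinearMap.range (treeRelations prev Y Z) := by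
    intro n
    induction n with
    | zero =>
      intro c hc h
      have hc' : c = Finsupp.single none (c none) := by
        ext o
        cases o with
        | none => simp
        | some b => simp [h b (hN b)]
      rw [hc', Finsupp.linearCombination_single, smul_eq_mul, mul_eq_zero] at hc
      rw [hc', hc.resolve_right hg, Finsupp.single_zero]
      exact zero_mem _
    | succ n ih =>
      intro c hc h
      -- `q` is the quotient on the single rank `N - n - 1` and zero elsewhere; subtracting its
      -- relation clears that rank.
      have hq : ∀ b, ∃ q, (ρ b + n < N → c (some b) = q * Y b) ∧ (ρ b + (n + 1) < N → q = 0) := by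
        intro b
        by_cases h1 : ρ b + (n + 1) < N
        · exact ⟨0, fun _ => by rw [h b h1, zero_mul], fun _ => rfl⟩
        · by_cases h2 : ρ b + n < N
          · obtain ⟨q, hq⟩ := hcolon b c hc fun a ha => h a (by omega)
            exact ⟨q, fun _ => by rw [hq, mul_comm], fun h => absurd h h1⟩
          · exact ⟨0, fun h => absurd h h2, fun _ => rfl⟩
      choose q hq hq0 using hq
      let x : A →₀ S := Finsupp.equivFunOnFinite.symm q
      have hmem := ih (c - treeRelations prev Y Z x) (by rw [map_sub, hc, hcomp, sub_zero])
        (fun b hb => by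
          rw [Finsupp.sub_apply, treeRelations_apply hρ x b fun a ha => hq0 a (by omega), hq b hb]
          exact sub_self _)
      have := Submodule.add_mem _ hmem (LinearMap.mem_range_self (treeRelations prev Y Z) x)
      rwa [sub_add_cancel] at this
  intro c
  constructor
  · intro hc
    exact key N c hc fun b hb => absurd hb (by omega)
  · rintro ⟨x, rfl⟩
    exact hcomp x

end TreeResolution

/-! ### Monomial ideals with a tree of relations, and their regularity. -/

/-- Combinatorial data of a monomial ideal with generators `x^(T o)` and relations
`x^(η a) * x^(T (some a)) ∈ (x^(T (prev a)))`. -/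
structure MonomialTree (V : Type*) (A : Type) where
  /-- The exponents of the generators. -/
  T : Option A → V →₀ ℕ
  /-- The exponents of the leading coefficients of the relations. -/
  η : A → V →₀ ℕ
  /-- The second generator of a relation. -/
  prev : A → Option A
  /-- The rank of a generator, which increases along `prev`. -/
  ρ : A → ℕ
  rank_lt : ∀ a b, prev a = some b → ρ a < ρ b
  T_prev_le : ∀ a, T (prev a) ≤ T (some a) + η a
  T_prev_ne : ∀ a, T (prev a) ≠ T (some a) + η a
  η_ne : ∀ a, η a ≠ 0
  le_T : ∀ a o, o ≠ some a → (∀ b, o = some b → ρ a ≤ ρ b) →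
    ∀ v, η a v ≠ 0 → T (some a) v + η a v ≤ T o v

namespace MonomialTree

variable {V : Type*} {A : Type} (M : MonomialTree V A) (K : Type*) [Field K]

/-- The generators of the ideal. -/
def gen (o : Option A) : MvPolynomial V K := monomial (M.T o) 1

/-- The first coefficient of a relation. -/
def coeffY (a : A) : MvPolynomial V K := monomial (M.η a) 1

/-- The second coefficient of a relation. -/
def coeffZ (a : A) : MvPolynomial V K := monomial (M.T (some a) + M.η a - M.T (M.prev a)) 1

/-- The monomial ideal. -/
def ideal : Ideal (MvPolynomial V K) := Ideal.span (Set.range (M.gen K))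

variable {K}

theorem mem_ideal {f : MvPolynomial V K} :
    f ∈ M.ideal K ↔ ∀ u ∈ f.support, ∃ o, M.T o ≤ u := by
  have h : Set.range (M.gen K) = (fun s => monomial s (1 : K)) '' Set.range M.T := by
    rw [← Set.range_comp]
    rfl
  rw [ideal, h, mem_ideal_span_monomial_image]
  simp

/-- If a monomial `u` of `c (some a)` had `u v < η a v`, then by `le_T` no other generator still
present would divide `x^(u + T (some a))`, and its coefficient could not cancel. -/
theorem colon [Fintype A] (a : A) (c : Option A →₀ MvPolynomial V K)
    (hc : Finsupp.linearCombination _ (M.gen K) c = 0)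
    (h : ∀ b, M.ρ b < M.ρ a → c (some b) = 0) : M.coeffY K a ∣ c (some a) := by
  classical
  have hdvd : ∀ u ∈ (c (some a)).support, M.η a ≤ u := by
    intro u hu v
    by_contra! hv
    rw [Finsupp.linearCombination_apply, Finsupp.sum_fintype _ _ (by simp)] at hc
    have hcoeff := congrArg (coeff (u + M.T (some a))) hc
    rw [coeff_sum, Finset.sum_eq_single (some a)] at hcoeff
    · rw [smul_eq_mul, gen, coeff_mul_monomial, mul_one, coeff_zero] at hcoeff
      exact mem_support_iff.1 hu hcoeff
    · intro o _ ho
      rw [smul_eq_mul, gen, coeff_mul_monomial']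
      split_ifs with hle
      · by_cases hb : ∃ b, o = some b ∧ M.ρ b < M.ρ a
        · obtain ⟨b, rfl, hb⟩ := hb
          simp [h b hb]
        · have h1 := M.le_T a o ho (fun b hob => by
            by_contra! hlt
            exact hb ⟨b, hob, hlt⟩) v (by omega)
          have h2 := hle v
          rw [Finsupp.add_apply] at h2
          omega
      · rfl
    · simp
  have hmem : c (some a) ∈ Ideal.span ((fun s => monomial s (1 : K)) '' {M.η a}) :=
    mem_ideal_span_monomial_image.2 fun u hu => ⟨_, rfl, hdvd u hu⟩
  rw [Set.image_singleton] at hmem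
  exact Ideal.mem_span_singleton.1 hmem

theorem relation (a : A) :
    M.coeffY K a * M.gen K (some a) = M.coeffZ K a * M.gen K (M.prev a) := by
  rw [coeffY, coeffZ, gen, gen, monomial_mul, monomial_mul, tsub_add_cancel_of_le (M.T_prev_le a),
    add_comm (M.η a)]

variable (K) in
/-- The relations of the generators. -/
def relations : (A →₀ MvPolynomial V K) →ₗ[MvPolynomial V K] (Option A →₀ MvPolynomial V K) :=
  treeRelations M.prev (M.coeffY K) (M.coeffZ K)

theorem relations_injective [Fintype A] : Function.Injective (M.relations K) :=
  treeRelations_injective M.rank_lt fun a => by simp [coeffY]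

theorem relations_exact [Fintype A] :
    Function.Exact (M.relations K) (Finsupp.linearCombination _ (M.gen K)) :=
  treeRelations_exact M.rank_lt (by simp [gen]) M.relation M.colon

theorem relations_single (a : A) : M.relations K (Finsupp.single a 1) =
    Finsupp.single (some a) (M.coeffY K a) - Finsupp.single (M.prev a) (M.coeffZ K a) := by
  simp [relations, treeRelations]

/-- The index sets of the bases in the resolution. -/
def Idx (A : Type) : ℕ → Type
  | 0 => Option A
  | 1 => A
  | _ + 2 => Empty

/-- The degrees of the basis elements in the resolution. -/
def idxDeg : ∀ i, Idx A i → ℕ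
  | 0 => fun o => (M.T o).degree
  | 1 => fun a => (M.T (some a) + M.η a).degree
  | _ + 2 => Empty.elim

variable (K) in
/-- The differentials of the resolution. -/
def differential : ∀ i, (Idx A (i + 1) →₀ MvPolynomial V K) →ₗ[MvPolynomial V K]
    (Idx A i →₀ MvPolynomial V K)
  | 0 => M.relations K
  | _ + 1 => 0

variable (K) in
/-- The augmentation of the resolution. -/
def augmentation : (Idx A 0 →₀ MvPolynomial V K) →ₗ[MvPolynomial V K] M.ideal K :=
  (Finsupp.linearCombination (MvPolynomial V K) (M.gen K)).codRestrict (M.ideal K) fun c => by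
    have h : Finsupp.linearCombination _ (M.gen K) c ∈
        LinearMap.range (Finsupp.linearCombination (MvPolynomial V K) (M.gen K)) := ⟨c, rfl⟩
    rwa [Finsupp.range_linearCombination] at h

theorem coe_augmentation (c : Option A →₀ MvPolynomial V K) :
    (M.augmentation K c : MvPolynomial V K) = Finsupp.linearCombination _ (M.gen K) c := rfl

theorem augmentation_homogeneous (o : Option A) :
    (M.augmentation K (Finsupp.single o 1) : MvPolynomial V K).IsHomogeneous (M.T o).degree := by
  have h : (M.augmentation K (Finsupp.single o 1) : MvPolynomial V K) = M.gen K o :=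
    (M.coe_augmentation (Finsupp.single o 1)).trans (by simp)
  rw [h]
  exact isHomogeneous_monomial _ rfl

theorem relations_homogeneous (a : A) (o : Option A) (u : V →₀ ℕ)
    (h : coeff u (M.relations K (Finsupp.single a 1) o) ≠ 0) :
    u.degree + (M.T o).degree = (M.T (some a) + M.η a).degree := by
  classical
  rw [relations_single, Finsupp.sub_apply, coeff_sub, coeffY, coeffZ, Finsupp.single_apply,
    Finsupp.single_apply] at h
  have h' : (some a = o ∧ M.η a = u) ∨
      (M.prev a = o ∧ M.T (some a) + M.η a - M.T (M.prev a) = u) := by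
    by_contra! hn
    apply h
    split_ifs with h1 h2 h2 <;> simp_all [coeff_monomial]
  obtain ⟨rfl, rfl⟩ | ⟨rfl, rfl⟩ := h'
  · rw [← map_add, add_comm]
  · rw [← map_add, tsub_add_cancel_of_le (M.T_prev_le a)]

theorem augmentation_surjective : Function.Surjective (M.augmentation K) := by
  intro f
  have h : (f : MvPolynomial V K) ∈ Submodule.span _ (Set.range (M.gen K)) := f.2
  rw [← Finsupp.range_linearCombination] at h
  obtain ⟨c, hc⟩ := h
  exact ⟨c, Subtype.ext hc⟩

/-- This is minimality: `η_ne` and `T_prev_ne` make both coefficients of a relation nonconstant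
monomials. -/
theorem constantCoeff_relations (a : A) (o : Option A) :
    constantCoeff (M.relations K (Finsupp.single a 1) o) = 0 := by
  classical
  have h0 : M.T (some a) + M.η a - M.T (M.prev a) ≠ 0 := fun h =>
    M.T_prev_ne a (le_antisymm (M.T_prev_le a) (tsub_eq_zero_iff_le.1 h))
  rw [relations_single, Finsupp.sub_apply, map_sub, coeffY, coeffZ, Finsupp.single_apply,
    Finsupp.single_apply]
  split_ifs <;> simp [constantCoeff_monomial, M.η_ne a, h0]

variable [Fintype A]

variable (K) in
/-- The minimal graded free resolution of the ideal. -/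
def resolution : GradedFreeResolution (M.ideal K) where
  Gen := Idx A
  deg := M.idxDeg
  aug := M.augmentation K
  d := M.differential K
  aug_homogeneous := M.augmentation_homogeneous
  d_homogeneous i := match i with
    | 0 => M.relations_homogeneous
    | _ + 1 => fun b => b.elim
  aug_surjective := M.augmentation_surjective
  exact_zero c := Subtype.coe_inj.symm.trans (M.relations_exact c)
  exact_succ := by
    intro i
    match i with
    | 0 =>
      exact fun x => (map_eq_zero_iff (M.relations K) M.relations_injective (x := x)).trans
        ⟨fun h => ⟨0, h.symm⟩, fun ⟨_, h⟩ => h.symm⟩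
    | _ + 1 =>
      intro x
      have : x = 0 := Finsupp.ext fun b => b.elim
      exact ⟨fun _ => ⟨0, this.symm⟩, fun _ => by rw [this, map_zero]⟩

theorem resolution_dBar (i : ℕ) : (M.resolution K).dBar i = 0 := by
  refine Finsupp.lhom_ext' fun a => LinearMap.ext_ring ?_
  match i, a with
  | 0, a =>
    ext o
    have h1 : constantCoeff ((M.resolution K).d 0 (Finsupp.single a 1) o) = 0 :=
      M.constantCoeff_relations a o
    simpa [GradedFreeResolution.dBar] using h1
  | _ + 1, a => exact Empty.elim a

theorem nontrivial_resolution_tor_iff (i j : ℕ) :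
    Nontrivial ((M.resolution K).Tor i j) ↔ ∃ b, (M.resolution K).deg i b = j := by
  rw [GradedFreeResolution.nontrivial_tor_iff, GradedFreeResolution.boundaries, resolution_dBar,
    Submodule.map_zero, le_bot_iff]
  have hc : (M.resolution K).cycles i j = (M.resolution K).part i j := by
    cases i with
    | zero => rfl
    | succ i => simp [GradedFreeResolution.cycles, resolution_dBar]
  rw [hc, GradedFreeResolution.part]
  constructor
  · intro h
    by_contra! hb
    refine h ?_
    rw [show {b | (M.resolution K).deg i b = j} = ∅ from Set.eq_empty_of_forall_notMem hb]
    simp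
  · rintro ⟨b, hb⟩ h
    have h1 : Finsupp.single b (1 : K) ∈
        Finsupp.supported K K {b | (M.resolution K).deg i b = j} :=
      Finsupp.single_mem_supported K 1 hb
    rw [h, Submodule.mem_bot, Finsupp.single_eq_zero] at h1
    exact one_ne_zero h1

/-- The regularity of the ideal in terms of the degrees of its minimal resolution. -/
theorem hasRegularity {r : ℤ} (h0 : ∀ o, ((M.T o).degree : ℤ) ≤ r)
    (h1 : ∀ a, ((M.T (some a) + M.η a).degree : ℤ) - 1 ≤ r)
    (hr : ∃ a, ((M.T (some a) + M.η a).degree : ℤ) - 1 = r) : HasRegularity (M.ideal K) r := by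
  refine ⟨⟨M.resolution K⟩, fun F => ⟨?_, ?_⟩⟩
  · obtain ⟨a, ha⟩ := hr
    refine ⟨1, (M.T (some a) + M.η a).degree, ?_, by rw [← ha]; rfl⟩
    refine GradedFreeResolution.nontrivial_tor_of_nontrivial (M.resolution K) F ?_
    rw [nontrivial_resolution_tor_iff]
    exact ⟨a, rfl⟩
  · rintro _ ⟨i, j, hij, rfl⟩
    have h := GradedFreeResolution.nontrivial_tor_of_nontrivial F (M.resolution K) hij
    rw [nontrivial_resolution_tor_iff] at h
    obtain ⟨b, rfl⟩ := h
    match i, b with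
    | 0, o => exact (sub_zero _).trans_le (h0 o)
    | 1, a => exact h1 a
    | _ + 2, b => exact Empty.elim b

end MonomialTree

end

/-! ### Edge ideals `(X x, X y)^s` and symbolic powers of cover ideals. -/

noncomputable section
open MvPolynomial

section PairIdeal

variable (K : Type*) [Field K] {V : Type*}

/-- The ideal `(X x, X y)^s`, spanned by the monomials `X^t` with `s ≤ t x + t y`. -/
def pairIdeal (x y : V) (s : ℕ) : Ideal (MvPolynomial V K) :=
  Ideal.span ((fun t => monomial t (1 : K)) '' {t | s ≤ t x + t y})

variable {K} {x y : V} {s : ℕ}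

theorem mem_pairIdeal {f : MvPolynomial V K} :
    f ∈ pairIdeal K x y s ↔ ∀ u ∈ f.support, s ≤ u x + u y := by
  rw [pairIdeal, mem_ideal_span_monomial_image]
  refine forall₂_congr fun u _ => ⟨?_, fun h => ⟨u, h, le_rfl⟩⟩
  rintro ⟨t, ht, hle⟩
  exact le_trans ht (add_le_add (hle x) (hle y))

theorem X_mem_pairIdeal_iff {v : V} : (X v : MvPolynomial V K) ∈ pairIdeal K x y 1 ↔
    v = x ∨ v = y := by
  classical
  rw [mem_pairIdeal, support_X]
  simp only [Finset.mem_singleton, forall_eq, Finsupp.single_apply]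
  split_ifs <;> simp_all

/-- The weighted order is additive on products over a field, which yields multiplicativity,
primeness and cancellation below. -/
theorem mem_pairIdeal_iff_weightedOrder [Fintype V] [DecidableEq V] {f : MvPolynomial V K} :
    f ∈ pairIdeal K x y s ↔
      (s : ℕ∞) ≤ (f : MvPowerSeries V K).weightedOrder (Pi.single x 1 + Pi.single y 1) := by
  have hw : ∀ u : V →₀ ℕ, Finsupp.weight (Pi.single x 1 + Pi.single y 1 : V → ℕ) u = u x + u y := by
    intro u
    rw [Finsupp.weight_apply, Finsupp.sum_fintype _ _ (by simp)]
    simp [mul_add, Finset.sum_add_distrib, Pi.single_apply]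
  rw [mem_pairIdeal]
  constructor
  · intro h
    refine MvPowerSeries.nat_le_weightedOrder _ fun u hu => ?_
    rw [hw] at hu
    rw [coeff_coe]
    by_contra hne
    exact absurd (h u (mem_support_iff.2 hne)) (by omega)
  · intro h u hu
    have h1 := MvPowerSeries.weightedOrder_le (f := (f : MvPowerSeries V K))
      (w := Pi.single x 1 + Pi.single y 1) (d := u)
      (by rw [coeff_coe]; exact mem_support_iff.1 hu)
    rw [hw] at h1
    exact_mod_cast h.trans h1

variable [Fintype V]

theorem mul_mem_pairIdeal {a b : ℕ} {f g : MvPolynomial V K} (hf : f ∈ pairIdeal K x y a)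
    (hg : g ∈ pairIdeal K x y b) : f * g ∈ pairIdeal K x y (a + b) := by
  classical
  rw [mem_pairIdeal_iff_weightedOrder] at hf hg ⊢
  rw [coe_mul, MvPowerSeries.weightedOrder_mul, Nat.cast_add]
  exact add_le_add hf hg

theorem mem_pairIdeal_of_mul_mem {f g : MvPolynomial V K} (h : f * g ∈ pairIdeal K x y s)
    (hf : f ∉ pairIdeal K x y 1) : g ∈ pairIdeal K x y s := by
  classical
  rw [mem_pairIdeal_iff_weightedOrder] at h hf ⊢
  rw [coe_mul, MvPowerSeries.weightedOrder_mul] at h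
  rw [Nat.cast_one, Order.one_le_iff_ne_zero, not_not] at hf
  rwa [hf, zero_add] at h

theorem pairIdeal_isPrime : (pairIdeal K x y 1).IsPrime := by
  refine ⟨?_, fun {f g} h => or_iff_not_imp_left.2 (mem_pairIdeal_of_mul_mem h)⟩
  rw [Ideal.ne_top_iff_one, mem_pairIdeal]
  intro h
  have := h 0 (by simp)
  simp at this

theorem pow_le_pairIdeal {J : Ideal (MvPolynomial V K)} (hJ : J ≤ pairIdeal K x y 1) (s : ℕ) :
    J ^ s ≤ pairIdeal K x y s := by
  induction s with
  | zero => exact fun f _ => mem_pairIdeal.2 fun u _ => Nat.zero_le _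
  | succ s ih =>
    rw [pow_succ, Ideal.mul_le]
    exact fun f hf g hg => mul_mem_pairIdeal (ih hf) (hJ hg)

end PairIdeal

section SymbolicPower

variable (K : Type*) [Field K] {V : Type*} (G : SimpleGraph V)

/-- The intersection of the ideals `(X x, X y)^s` over the edges `xy` of a graph. -/
def edgePowerIdeal (s : ℕ) : Ideal (MvPolynomial V K) :=
  ⨅ (x : V) (y : V) (_ : G.Adj x y), pairIdeal K x y s

variable {K G}

theorem mem_edgePowerIdeal {s : ℕ} {f : MvPolynomial V K} :
    f ∈ edgePowerIdeal K G s ↔ ∀ x y, G.Adj x y → f ∈ pairIdeal K x y s := by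
  simp [edgePowerIdeal, Submodule.mem_iInf]

/-- The support of a monomial lying in every `(X x, X y)` is a vertex cover, hence contains a
minimal one. -/
theorem coverIdeal_eq : coverIdeal K G = edgePowerIdeal K G 1 := by
  classical
  apply le_antisymm
  · rw [coverIdeal, Ideal.span_le]
    rintro _ ⟨w, hw, rfl⟩
    rw [SetLike.mem_coe, mem_edgePowerIdeal]
    intro x y hxy
    obtain h | h := hw.1 hxy
    · exact Ideal.mem_of_dvd _ (Finset.dvd_prod_of_mem _ h) (X_mem_pairIdeal_iff.2 (.inl rfl))
    · exact Ideal.mem_of_dvd _ (Finset.dvd_prod_of_mem _ h) (X_mem_pairIdeal_iff.2 (.inr rfl))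
  · intro f hf
    rw [mem_edgePowerIdeal] at hf
    rw [← support_sum_monomial_coeff f]
    refine Submodule.sum_mem _ fun u hu => ?_
    have hcover : G.IsVertexCover (u.support : Set V) := by
      intro x y hxy
      have := mem_pairIdeal.1 (hf x y hxy) u hu
      simp only [Finset.mem_coe, Finsupp.mem_support_iff]
      omega
    obtain ⟨w, hw, hmin⟩ := exists_minimal_le_of_wellFoundedLT
      (fun c : Finset V => G.IsVertexCover (c : Set V)) u.support hcover
    refine Ideal.mem_of_dvd _ ?_ (Ideal.subset_span ⟨w, hmin, rfl⟩)
    rw [monomial_eq, Finsupp.prod]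
    refine Dvd.dvd.mul_left ?_ _
    refine (Finset.prod_dvd_prod_of_dvd _ _ fun v hv => ?_).trans
      (Finset.prod_dvd_prod_of_subset w u.support (fun v => X v ^ u v) hw)
    exact dvd_pow_self _ (Finsupp.mem_support_iff.1 (hw hv))

theorem coverIdeal_le_pairIdeal {x y : V} (h : G.Adj x y) :
    coverIdeal K G ≤ pairIdeal K x y 1 :=
  fun _ hf => mem_edgePowerIdeal.1 (coverIdeal_eq (K := K) (G := G) ▸ hf) x y h

variable [Fintype V]

variable (K) in
/-- The product of the variables other than `X x` and `X y`. -/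
def coProd [DecidableEq V] (x y : V) : MvPolynomial V K := ∏ v ∈ Finset.univ \ {x, y}, X v

section

variable [DecidableEq V] {x y : V}

theorem coProd_notMem : coProd K x y ∉ pairIdeal K x y 1 := by
  have := pairIdeal_isPrime (K := K) (x := x) (y := y)
  rw [coProd, Ideal.IsPrime.prod_mem_iff]
  rintro ⟨v, hv, h⟩
  rw [X_mem_pairIdeal_iff] at h
  simp at hv
  tauto

/-- The variables of `coProd` cover every edge except a possible edge `xy`, which `z` covers. -/
theorem X_mul_coProd_mem {z : V} (hz : z = x ∨ z = y) :
    X z * coProd K x y ∈ coverIdeal K G := by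
  rw [coverIdeal_eq, mem_edgePowerIdeal]
  intro a b hab
  by_cases ha : a = x ∨ a = y
  · by_cases hb : b = x ∨ b = y
    · refine Ideal.mul_mem_right _ _ (X_mem_pairIdeal_iff.2 ?_)
      have := hab.ne
      grind
    · refine Ideal.mul_mem_left _ _ (Ideal.mem_of_dvd _ (Finset.dvd_prod_of_mem _ ?_)
        (X_mem_pairIdeal_iff.2 (.inr rfl)))
      simpa using hb
  · refine Ideal.mul_mem_left _ _ (Ideal.mem_of_dvd _ (Finset.dvd_prod_of_mem _ ?_)
      (X_mem_pairIdeal_iff.2 (.inl rfl)))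
    simpa using ha

theorem monomial_mul_coProd_pow_mem (hxy : x ≠ y) (s : ℕ) (t : V →₀ ℕ) (ht : s ≤ t x + t y) :
    monomial t 1 * coProd K x y ^ s ∈ coverIdeal K G ^ s := by
  induction s generalizing t with
  | zero => simp
  | succ s ih =>
    obtain ⟨z, hz, hzt⟩ : ∃ z, (z = x ∨ z = y) ∧ t z ≠ 0 := by
      by_cases h : t x = 0
      · exact ⟨y, .inr rfl, by omega⟩
      · exact ⟨x, .inl rfl, h⟩
    obtain ⟨t', rfl⟩ : ∃ t', t = t' + Finsupp.single z 1 :=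
      ⟨t - Finsupp.single z 1, (tsub_add_cancel_of_le (by
        simpa using Nat.one_le_iff_ne_zero.2 hzt)).symm⟩
    have h1 := ih t' (by
      simp only [Finsupp.add_apply, Finsupp.single_apply] at ht
      split_ifs at ht <;> first | omega | (subst_vars; tauto))
    have h2 := X_mul_coProd_mem (K := K) (G := G) hz
    have := Ideal.mul_mem_mul h1 h2
    rw [← pow_succ] at this
    convert this using 1
    rw [show (X z : MvPolynomial V K) = monomial (Finsupp.single z 1) 1 from rfl, pow_succ]
    have : monomial (t' + Finsupp.single z 1) (1 : K) =
        monomial t' 1 * monomial (Finsupp.single z 1) 1 := by rw [monomial_mul, one_mul]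
    rw [this]
    ring

/-- `coProd` is a unit at the prime `(X x, X y)`; with denominators cleared, this says that `(X x, X
y)^s` is locally contained in `J(G)^s`. -/
theorem mul_coProd_pow_mem (hxy : x ≠ y) {s : ℕ} {f : MvPolynomial V K} (hf : f ∈ pairIdeal K x y s) :
    f * coProd K x y ^ s ∈ coverIdeal K G ^ s := by
  rw [pairIdeal] at hf
  induction hf using Submodule.span_induction with
  | mem f hf =>
    obtain ⟨t, ht, rfl⟩ := hf
    exact monomial_mul_coProd_pow_mem hxy s t ht
  | zero => simp
  | add f g _ _ hf hg => rw [add_mul]; exact add_mem hf hg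
  | smul a f _ hf => rw [smul_eq_mul, mul_assoc]; exact Ideal.mul_mem_left _ _ hf

end

/-- The associated primes of a cover ideal are generated by the ends of the edges. -/
theorem mem_associatedPrimes_coverIdeal_iff {P : Ideal (MvPolynomial V K)} :
    P ∈ associatedPrimes _ (MvPolynomial V K ⧸ coverIdeal K G) ↔
      ∃ x y, G.Adj x y ∧ P = pairIdeal K x y 1 := by
  classical
  have hcolon : ∀ f g : MvPolynomial V K, g ∈ Submodule.colon
      (⊥ : Submodule (MvPolynomial V K) (MvPolynomial V K ⧸ coverIdeal K G))
      {Ideal.Quotient.mk (coverIdeal K G) f} ↔ g * f ∈ coverIdeal K G := by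
    intro f g
    rw [Submodule.mem_colon_singleton, Submodule.mem_bot, ← Ideal.Quotient.eq_zero_iff_mem,
      map_mul]
    rfl
  rw [AssociatedPrimes.mem_iff, isAssociatedPrime_iff]
  constructor
  · rintro ⟨hP, f, hf⟩
    obtain ⟨f, rfl⟩ := Ideal.Quotient.mk_surjective f
    have hPf : ∀ g, g ∈ P ↔ g * f ∈ coverIdeal K G := fun g => by rw [← hcolon, ← hf]
    by_contra! hne
    -- If `P` is no edge prime, each edge has a multiplier outside `P` bringing `f` into its ideal.
    -- Their product then lies in `(J(G) : f) = P`, against primeness.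
    have hh : ∀ e : V × V, ∃ h, h ∉ P ∧ (G.Adj e.1 e.2 → h * f ∈ pairIdeal K e.1 e.2 1) := by
      intro e
      by_cases he : G.Adj e.1 e.2
      · by_cases hfe : f ∈ pairIdeal K e.1 e.2 1
        · exact ⟨1, fun h => hP.ne_top ((Ideal.eq_top_iff_one _).2 h), fun _ => by rwa [one_mul]⟩
        · have hle : P ≤ pairIdeal K e.1 e.2 1 := fun g hg => by
            refine mem_pairIdeal_of_mul_mem ?_ hfe
            rw [mul_comm]
            exact coverIdeal_le_pairIdeal he ((hPf g).1 hg)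
          have hnle : ¬ pairIdeal K e.1 e.2 1 ≤ P := fun h => hne _ _ he (le_antisymm hle h)
          obtain ⟨h, h1, h2⟩ := SetLike.not_le_iff_exists.1 hnle
          exact ⟨h, h2, fun _ => Ideal.mul_mem_right _ _ h1⟩
      · exact ⟨1, fun h => hP.ne_top ((Ideal.eq_top_iff_one _).2 h), fun h => absurd h he⟩
    choose h hh1 hh2 using hh
    have hprod : (∏ e, h e) ∈ P := by
      rw [hPf, coverIdeal_eq, mem_edgePowerIdeal]
      intro x y hxy
      rw [← Finset.mul_prod_erase _ _ (Finset.mem_univ (x, y)), mul_right_comm]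
      exact Ideal.mul_mem_right _ _ (hh2 (x, y) hxy)
    obtain ⟨e, _, he⟩ := Ideal.IsPrime.prod_mem_iff.1 hprod
    exact hh1 e he
  · rintro ⟨x, y, hxy, rfl⟩
    refine ⟨pairIdeal_isPrime, Ideal.Quotient.mk _ (coProd K x y), ?_⟩
    ext g
    rw [hcolon]
    constructor
    · intro hg
      simpa using mul_coProd_pow_mem (G := G) hxy.ne hg
    · intro hg
      refine mem_pairIdeal_of_mul_mem ?_ coProd_notMem
      rw [mul_comm]
      exact coverIdeal_le_pairIdeal hxy hg

/-- The symbolic powers of a cover ideal are the intersections of the powers of the ideals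
`(X x, X y)`. -/
theorem symbolicPower_coverIdeal (s : ℕ) :
    symbolicPower (coverIdeal K G) s = edgePowerIdeal K G s := by
  classical
  ext f
  simp only [symbolicPower, Submodule.mem_iInf, mem_edgePowerIdeal]
  constructor
  · intro h x y hxy
    have hP := mem_associatedPrimes_coverIdeal_iff (K := K) (G := G).2 ⟨x, y, hxy, rfl⟩
    have := pairIdeal_isPrime (K := K) (x := x) (y := y)
    have h1 := h _ hP
    rw [Ideal.mem_comap, IsLocalization.algebraMap_mem_map_algebraMap_iff
      (pairIdeal K x y 1).primeCompl] at h1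
    obtain ⟨m, hm, hmf⟩ := h1
    exact mem_pairIdeal_of_mul_mem (pow_le_pairIdeal (coverIdeal_le_pairIdeal hxy) s hmf) hm
  · intro h P hP
    obtain ⟨x, y, hxy, rfl⟩ := mem_associatedPrimes_coverIdeal_iff.1 hP
    have := pairIdeal_isPrime (K := K) (x := x) (y := y)
    rw [Ideal.mem_comap, IsLocalization.algebraMap_mem_map_algebraMap_iff
      (pairIdeal K x y 1).primeCompl]
    refine ⟨coProd K x y ^ s, fun hmem => coProd_notMem (this.mem_of_pow_mem s hmem), ?_⟩
    rw [mul_comm]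
    exact mul_coProd_pow_mem hxy.ne (h x y hxy)

end SymbolicPower

end

/-! ### Complete multipartite graphs: generators, relations and degrees. -/

noncomputable section
open MvPolynomial

section Multipartite

variable {k : ℕ} (p : Fin k → ℕ)

/-- The exponent vector which is constant on the parts of a multipartite graph. -/
def partExp (a : Fin k → ℕ) : (Σ i, Fin (p i)) →₀ ℕ :=
  Finsupp.equivFunOnFinite.symm fun v => a v.1

@[simp]
theorem partExp_apply (a : Fin k → ℕ) (v : Σ i, Fin (p i)) : partExp p a v = a v.1 := rfl

theorem degree_partExp (a : Fin k → ℕ) : (partExp p a).degree = ∑ i, p i * a i := by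
  rw [Finsupp.degree_eq_sum, Fintype.sum_sigma]
  simp

/-- The pairs of a part `i` and an exponent `m < s / 2`, except for the middle exponent in the
part `z`. -/
abbrev GenIdx (z : Fin k) (s : ℕ) : Type :=
  {a : Fin k × Fin s // 2 * (a.2 : ℕ) < s ∧ (2 * (a.2 : ℕ) + 1 = s → a.1 ≠ z)}

/-- The exponents on the parts of the minimal generators of a symbolic power. -/
def genExp (z : Fin k) (s : ℕ) : Option (GenIdx z s) → Fin k → ℕ
  | none => fun j => if j = z then s / 2 else (s + 1) / 2
  | some a => fun j => if j = a.1.1 then (a.1.2 : ℕ) else s - a.1.2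

/-- The generator with the next exponent in the same part, if there is one. -/
def nextIdx (z : Fin k) (s : ℕ) (a : GenIdx z s) : Option (GenIdx z s) :=
  if h : 2 * ((a.1.2 : ℕ) + 1) < s ∧ (2 * ((a.1.2 : ℕ) + 1) + 1 = s → a.1.1 ≠ z) then
    some ⟨(a.1.1, ⟨a.1.2 + 1, by omega⟩), h⟩
  else none

variable {p}

/-- The first half makes the next generator divide the shifted one; the strict drop on another part
makes the relation minimal. -/
theorem genExp_nextIdx (z : Fin k) (s : ℕ) (a : GenIdx z s) (j : Fin k) :
    genExp z s (nextIdx z s a) j ≤ genExp z s (some a) j + (if j = a.1.1 then 1 else 0) ∧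
    (j ≠ a.1.1 → (a.1.1 ≠ z → j = z) → genExp z s (nextIdx z s a) j < genExp z s (some a) j) := by
  obtain ⟨⟨i, m, hm⟩, h1, h2⟩ := a
  simp only at h1 h2
  by_cases h : 2 * (m + 1) < s ∧ (2 * (m + 1) + 1 = s → i ≠ z)
  · simp only [nextIdx, h, genExp]
    split_ifs <;> simp_all
    omega
  · simp only [nextIdx, h, genExp, dif_neg, not_false_eq_true]
    -- The last `m` before the root: `(s-1)/2` off part `z` or `(s-3)/2` on it for odd `s`, and `s/2
    -- - 1` for even `s`.
    have h' : 2 * m + 1 = s ∧ i ≠ z ∨ 2 * m + 2 = s ∨ 2 * m + 3 = s ∧ i = z := by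
      by_cases hz : i = z
      · simp [hz] at h h2 ⊢
        omega
      · simp [hz] at h h2 ⊢
        omega
    rcases h' with ⟨h', hz⟩ | h' | ⟨h', hz⟩
    · split_ifs <;> simp_all <;> omega
    · split_ifs <;> simp_all <;> omega
    · split_ifs <;> simp_all <;> omega

/-- On the part of `a`, generators of other parts have exponent above `s/2`, and later ones of the
same part exceed `m`. For the root on part `z`, the excluded middle exponent is what gives `m + 1 ≤
s/2`. -/
theorem genExp_add_one_le (z : Fin k) (s : ℕ) (a : GenIdx z s) (o : Option (GenIdx z s))
    (ho : o ≠ some a) (h : ∀ b, o = some b → (a.1.2 : ℕ) ≤ b.1.2) :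
    (a.1.2 : ℕ) + 1 ≤ genExp z s o a.1.1 := by
  obtain ⟨⟨i, m, hm⟩, h1, h2⟩ := a
  simp only at h1 h2
  cases o with
  | none =>
    simp only [genExp]
    split_ifs with hz
    · have := mt h2 (by simpa using hz)
      omega
    · omega
  | some b =>
    have hb := h b rfl
    obtain ⟨⟨i', m', hm'⟩, h1', h2'⟩ := b
    simp only [genExp] at hb h1' ⊢
    split_ifs with hi
    · subst hi
      have : m ≠ m' := fun hmm => ho (by subst hmm; rfl)
      omega
    · omega

theorem le_genExp_add_genExp (z : Fin k) (s : ℕ) (o : Option (GenIdx z s)) {i j : Fin k}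
    (hij : i ≠ j) : s ≤ genExp z s o i + genExp z s o j := by
  cases o with
  | none =>
    simp only [genExp]
    split_ifs with h1 h2
    · exact absurd (h1.trans h2.symm) hij
    all_goals omega
  | some a =>
    have := a.2.1
    simp only [genExp]
    split_ifs with h1 h2
    · exact absurd (h1.trans h2.symm) hij
    all_goals omega

variable (p)

/-- The resolution data of a symbolic power of the cover ideal of a complete multipartite graph. -/
def multipartiteTree (hk : 2 ≤ k) (hp : ∀ i, 1 ≤ p i) (z : Fin k) (s : ℕ) :
    MonomialTree (Σ i, Fin (p i)) (GenIdx z s) where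
  T o := partExp p (genExp z s o)
  η a := partExp p fun j => if j = a.1.1 then 1 else 0
  prev := nextIdx z s
  ρ a := a.1.2
  rank_lt a b h := by
    rw [nextIdx] at h
    split_ifs at h
    obtain rfl := Option.some.inj h
    simp
  T_prev_le a v := (genExp_nextIdx z s a v.1).1
  T_prev_ne a h := by
    obtain ⟨j, hj, hjz⟩ : ∃ j, j ≠ a.1.1 ∧ (a.1.1 ≠ z → j = z) := by
      by_cases hz : a.1.1 = z
      · have : Nontrivial (Fin k) := Fin.nontrivial_iff_two_le.2 hk
        obtain ⟨j, hj⟩ := exists_ne a.1.1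
        exact ⟨j, hj, fun h => absurd hz h⟩
      · exact ⟨z, Ne.symm hz, fun _ => rfl⟩
    have h1 := DFunLike.congr_fun h ⟨j, 0, hp j⟩
    have h2 := (genExp_nextIdx z s a j).2 hj hjz
    rw [Finsupp.add_apply, partExp_apply, partExp_apply, partExp_apply, if_neg hj] at h1
    simp only at h1
    omega
  η_ne a h := by
    have := DFunLike.congr_fun h ⟨a.1.1, 0, hp _⟩
    simp at this
  le_T a o ho h v hv := by
    have hv' : v.1 = a.1.1 := by
      by_contra hne
      simp [hne] at hv
    have := genExp_add_one_le z s a o ho h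
    simpa [hv', genExp] using this

theorem multipartiteTree_ideal (K : Type*) [Field K] (hk : 2 ≤ k) (hp : ∀ i, 1 ≤ p i) (z : Fin k)
    (s : ℕ) : (multipartiteTree p hk hp z s).ideal K =
      edgePowerIdeal K (SimpleGraph.completeMultipartiteGraph fun i : Fin k => Fin (p i)) s := by
  ext f
  rw [MonomialTree.mem_ideal, mem_edgePowerIdeal]
  simp only [mem_pairIdeal]
  constructor
  · intro h x y hxy u hu
    obtain ⟨o, ho⟩ := h u hu
    have hne : x.1 ≠ y.1 := by simpa using hxy
    exact (le_genExp_add_genExp z s o hne).trans (add_le_add (ho x) (ho y))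
  · intro h u hu
    have : Nonempty (Σ i, Fin (p i)) := ⟨⟨z, 0, hp z⟩⟩
    -- A vertex `v` of least exponent selects the divisor: vertices outside its part have exponent
    -- at least `s - u v`.
    obtain ⟨v, hv⟩ := Finite.exists_min u
    have hvw : ∀ w : Σ i, Fin (p i), w.1 ≠ v.1 → s ≤ u v + u w := fun w hw =>
      h v w (by simpa using hw.symm) u hu
    by_cases hgen : 2 * u v < s ∧ (2 * u v + 1 = s → v.1 ≠ z)
    · refine ⟨some ⟨(v.1, ⟨u v, by omega⟩), hgen⟩, fun w => ?_⟩
      change (if w.1 = v.1 then u v else s - u v) ≤ u w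
      split_ifs with hw
      · exact hv w
      · have := hvw w hw
        omega
    · refine ⟨none, fun w => ?_⟩
      change (if w.1 = z then s / 2 else (s + 1) / 2) ≤ u w
      have h1 := hv w
      by_cases h2 : s ≤ 2 * u v
      · split_ifs <;> omega
      · have h3 : 2 * u v + 1 = s ∧ v.1 = z := by
          by_contra! h3
          exact hgen ⟨by omega, h3⟩
        split_ifs with hw
        · omega
        · have := hvw w (by rwa [h3.2])
          omega

theorem sum_mul_ite (c : Fin k) (a b : ℤ) :
    ∑ i, (p i : ℤ) * (if i = c then a else b) = (∑ i, p i : ℕ) * b + p c * (a - b) := by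
  have : ∀ i, (p i : ℤ) * (if i = c then a else b) =
      p i * b + if i = c then (p i : ℤ) * (a - b) else 0 := by
    intro i
    split_ifs <;> ring
  simp only [this, Finset.sum_add_distrib, Finset.sum_ite_eq', Finset.mem_univ, if_true]
  push_cast
  rw [Finset.sum_mul]

theorem degree_T_none (hk : 2 ≤ k) (hp : ∀ i, 1 ≤ p i) (z : Fin k) (s : ℕ) :
    (((multipartiteTree p hk hp z s).T none).degree : ℤ) =
      (∑ i, p i : ℕ) * ((s + 1) / 2 : ℕ) + p z * ((s / 2 : ℕ) - ((s + 1) / 2 : ℕ)) := by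
  rw [multipartiteTree, degree_partExp, ← sum_mul_ite]
  push_cast [genExp]
  rfl

theorem degree_T_some (hk : 2 ≤ k) (hp : ∀ i, 1 ≤ p i) (z : Fin k) (s : ℕ) (a : GenIdx z s) :
    (((multipartiteTree p hk hp z s).T (some a)).degree : ℤ) =
      (∑ i, p i : ℕ) * (s - (a.1.2 : ℕ)) + p a.1.1 * (2 * (a.1.2 : ℕ) - s) := by
  have h := sum_mul_ite p a.1.1 (a.1.2 : ℕ) (s - (a.1.2 : ℕ))
  rw [multipartiteTree, degree_partExp]
  have h2 : (a.1.2 : ℕ) ≤ s := a.1.2.2.le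
  push_cast [genExp, h2]
  push_cast at h
  rw [h]
  ring

theorem degree_η (hk : 2 ≤ k) (hp : ∀ i, 1 ≤ p i) (z : Fin k) (s : ℕ) (a : GenIdx z s) :
    ((multipartiteTree p hk hp z s).η a).degree = p a.1.1 := by
  rw [multipartiteTree, degree_partExp]
  simp

/-- The regularity of the symbolic powers of the cover ideal of a complete multipartite graph,
where `l` is a smallest part. -/
theorem hasRegularity_symbolicPower (K : Type*) [Field K] (hp : ∀ i, 1 ≤ p i) {l z : Fin k}
    (hlz : l ≠ z) (hl : ∀ i, p l ≤ p i) {s : ℕ} (hs : 1 ≤ s) :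
    HasRegularity
      (symbolicPower
        (coverIdeal K (SimpleGraph.completeMultipartiteGraph fun i : Fin k => Fin (p i))) s)
      (s * ((∑ i, p i : ℕ) - p l) + p l - 1) := by
  have hk : 2 ≤ k := by
    have := l.2
    have := z.2
    have := Fin.val_ne_of_ne hlz
    omega
  rw [symbolicPower_coverIdeal, ← multipartiteTree_ideal p K hk hp z s]
  have h2 : 2 * (p l : ℤ) ≤ (∑ i, p i : ℕ) := by
    have h := Finset.sum_le_sum_of_subset (f := p) (Finset.subset_univ {l, z})
    rw [Finset.sum_pair hlz] at h
    have := hl z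
    omega
  have hl1 := hp l
  obtain ⟨n, hn⟩ : ∃ n : ℤ, ((∑ i, p i : ℕ) : ℤ) = n := ⟨_, rfl⟩
  rw [hn] at h2 ⊢
  -- With `a = (i, m)`, right minus left is `(s - 1 - 2m)(p_i - p_l) + m(n - 2 p_l)`.
  have hrel : ∀ a : GenIdx z s, n * (s - (a.1.2 : ℕ)) + p a.1.1 * (2 * (a.1.2 : ℕ) - s) + p a.1.1
      ≤ s * (n - p l) + p l := by
    intro a
    have hm : 0 ≤ (s : ℤ) - 1 - 2 * (a.1.2 : ℕ) := by
      have := a.2.1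
      omega
    have hP : 0 ≤ (p a.1.1 : ℤ) - p l := by
      have := hl a.1.1
      omega
    have h3 := mul_nonneg hm hP
    have h4 : 0 ≤ ((a.1.2 : ℕ) : ℤ) * (n - 2 * p l) := mul_nonneg (by positivity) (by linarith)
    linarith
  refine MonomialTree.hasRegularity _ ?_ ?_ ?_
  · intro o
    cases o with
    | none =>
      rw [degree_T_none, hn]
      obtain ⟨t, c, hc, h3, h4, hs'⟩ : ∃ t c : ℕ, c ≤ 1 ∧ s / 2 = t ∧ (s + 1) / 2 = t + c ∧
          s = 2 * t + c := ⟨s / 2, s % 2, by omega, rfl, by omega, by omega⟩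
      rw [h3, h4, hs']
      have h5 : 0 ≤ (t : ℤ) * (n - 2 * p l) := mul_nonneg (by positivity) (by linarith)
      have h6 : 0 ≤ (c : ℤ) * (p z - p l) := mul_nonneg (by positivity) (by
        have := hl z
        omega)
      have h7 : (1 : ℤ) ≤ p l := by exact_mod_cast hl1
      push_cast
      linarith
    | some a =>
      rw [degree_T_some, hn]
      have := hrel a
      have h7 : (1 : ℤ) ≤ p a.1.1 := by exact_mod_cast hp a.1.1
      linarith
  · intro a
    rw [map_add, Nat.cast_add, degree_T_some, degree_η, hn]
    have := hrel a
    linarith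
  -- The maximum is attained at `m = 0` on the smallest part `l`; for `s = 1` this index exists only
  -- because `l ≠ z`.
  · refine ⟨⟨(l, ⟨0, hs⟩), by simp; omega, fun _ => hlz⟩, ?_⟩
    rw [map_add, Nat.cast_add, degree_T_some, degree_η, hn]
    push_cast
    ring

/-- The minimal vertex covers of a complete multipartite graph are the complements of the parts. -/
theorem isMinimalVertexCover_iff (hp : ∀ i, 1 ≤ p i) (i₀ : Fin k)
    (w : Finset (Σ i, Fin (p i))) :
    IsMinimalVertexCover (SimpleGraph.completeMultipartiteGraph fun i : Fin k => Fin (p i)) w ↔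
      ∃ i, w = (Finset.univ.erase i).sigma fun _ => Finset.univ := by
  have hcover : ∀ i, (SimpleGraph.completeMultipartiteGraph
      fun i : Fin k => Fin (p i)).IsVertexCover
        (((Finset.univ.erase i).sigma fun _ => Finset.univ : Finset (Σ i, Fin (p i))) :
          Set (Σ i, Fin (p i))) := by
    intro i x y hxy
    have hne : x.1 ≠ y.1 := by simpa using hxy
    simp only [Finset.mem_coe, Finset.mem_sigma, Finset.mem_erase, Finset.mem_univ, and_true]
    by_contra! h
    exact hne (h.1.trans h.2.symm)
  constructor
  · intro hw
    obtain ⟨i, hi⟩ : ∃ i, ((Finset.univ.erase i).sigma fun _ => Finset.univ) ⊆ w := by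
      by_cases h : ∃ v, v ∉ w
      · obtain ⟨v, hv⟩ := h
        refine ⟨v.1, fun x hx => ?_⟩
        have hne : x.1 ≠ v.1 := by simpa using hx
        exact (hw.1 (show (SimpleGraph.completeMultipartiteGraph
          fun i : Fin k => Fin (p i)).Adj x v by simpa using hne)).resolve_right hv
      · push Not at h
        exact ⟨i₀, fun x _ => h x⟩
    exact ⟨i, le_antisymm (hw.2 (hcover i) hi) hi⟩
  · rintro ⟨i, rfl⟩
    refine ⟨hcover i, fun c hc hcx x hx => ?_⟩
    have hne : x.1 ≠ i := by simpa using hx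
    refine (hc (show (SimpleGraph.completeMultipartiteGraph fun i : Fin k => Fin (p i)).Adj x
      ⟨i, 0, hp i⟩ by simpa using hne)).resolve_right fun h => ?_
    have := hcx h
    simp at this

/-- The largest complement of a part omits a smallest one; the additive form avoids truncated
subtraction. -/
theorem degCoverIdeal_add (hp : ∀ i, 1 ≤ p i) {l : Fin k} (hl : ∀ i, p l ≤ p i) :
    degCoverIdeal (SimpleGraph.completeMultipartiteGraph fun i : Fin k => Fin (p i)) + p l =
      ∑ i, p i := by
  classical
  have hcard : ∀ i, ((Finset.univ.erase i).sigma fun _ => Finset.univ :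
      Finset (Σ i, Fin (p i))).card + p i = ∑ i, p i := by
    intro i
    simp [Finset.card_sigma, Finset.sum_erase_add]
  have h : degCoverIdeal (SimpleGraph.completeMultipartiteGraph fun i : Fin k => Fin (p i)) =
      ((Finset.univ.erase l).sigma fun _ => Finset.univ : Finset (Σ i, Fin (p i))).card := by
    apply le_antisymm
    · refine Finset.sup_le fun w hw => ?_
      obtain ⟨i, rfl⟩ := (isMinimalVertexCover_iff p hp l w).1 (Finset.mem_filter.1 hw).2
      have := hcard i
      have := hcard l
      have := hl i
      omega
    · exact Finset.le_sup (f := Finset.card) (Finset.mem_filter.2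
        ⟨Finset.mem_univ _, (isMinimalVertexCover_iff p hp l _).2 ⟨l, rfl⟩⟩)
  rw [h, hcard]

end Multipartite

end

theorem theorem4p6 (K : Type*) [Field K] (k : ℕ) (hk : 2 ≤ k) (p : Fin k → ℕ)
    (hp : ∀ i, 1 ≤ p i) (hanti : Antitone p) (s : ℕ) (hs : 1 ≤ s) :
    HasRegularity
        (symbolicPower
          (coverIdeal K (SimpleGraph.completeMultipartiteGraph fun i : Fin k => Fin (p i))) s)
        ((s : ℤ) *
            (degCoverIdeal (SimpleGraph.completeMultipartiteGraph fun i : Fin k => Fin (p i)) : ℤ)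
          + (p ⟨k - 1, by omega⟩ : ℤ) - 1) ∧
      (s : ℤ) *
            (degCoverIdeal (SimpleGraph.completeMultipartiteGraph fun i : Fin k => Fin (p i)) : ℤ)
          + (p ⟨k - 1, by omega⟩ : ℤ) - 1 =
        (s : ℤ) * (((∑ i, p i : ℕ) : ℤ) - (p ⟨k - 1, by omega⟩ : ℤ))
          + (p ⟨k - 1, by omega⟩ : ℤ) - 1 := by
  have hl : ∀ i, p ⟨k - 1, by omega⟩ ≤ p i := fun i => hanti (Fin.mk_le_mk.2 (by omega) :
    i ≤ ⟨k - 1, by omega⟩)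
  have hdeg := degCoverIdeal_add p hp hl
  -- Any part other than the last can serve as the root part `z`; part 0 is one since `k ≥ 2`.
  have hlz : (⟨k - 1, by omega⟩ : Fin k) ≠ ⟨0, by omega⟩ := by
    rw [Ne, Fin.mk.injEq]
    omega
  have hreg := hasRegularity_symbolicPower p K hp hlz hl hs
  rw [← hdeg] at hreg ⊢
  rw [Nat.cast_add, add_sub_cancel_right] at hreg ⊢
  exact ⟨hreg, rfl⟩
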